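/- For $d,s\ge 1$ let $\mathcal N_{d,s}$ be the set of neural networks $\Phi=((W^1,b^1),\dots,(W^L,b^L))$, $L\ge 1$, with $W^\ell\in\mathbb R^{n_\ell\times n_{\ell-1}}$, $b^\ell\in\mathbb R^{n_\ell}$, $n_0=d$, $n_L=s$. With $A_\ell(x)=W^\ell x+b^\ell$ and $\sigma(x)=\max(x,0)$ applied coordinatewise, put $R_\sigma\Phi=A_L\circ\sigma\circ A_{L-1}\circ\dots\circ\sigma\circ A_1$, $\operatorname{Depth}(\Phi)=L$ and $\operatorname{Size}(\Phi)=\sum_{\ell=1}^L(n_{\ell-1}+1)n_\ell$. For $g:[t_0,t_1]\to\mathbb R^m$ put $\|g\|_{L^p([t_0,t_1])}=\bigl(\sum_{j=1}^m\int_{t_0}^{t_1}|g_j(t)|^p\,dt\bigr)^{1/p}$. Let $m\ge 1$ and $k\ge 0$ be integers, $p>0$ real, $t_0<t_1$ and $x_0\in\mathbb R^m$. Let $f:[t_0,t_1]\times\mathbb R^m\to\mathbb R^m$ be of class $C^k$ and Lipschitz with respect to the second variable, uniformly in $t\in[t_0,t_1]$. Then the Cauchy problem $$X'(t)=f(t,X(t)),\qquad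 X(t_0)=x_0,$$ has a unique solution $X:[t_0,t_1]\to\mathbb R^m$, and $X\in C^{k+1}$. In particular there is a real $B$ with $$(t_1-t_0)^j\,|X_i^{(j)}(t)|\le B\qquad\text{for all } 0\le j\le k+1,\ 1\le i\le m,\ t\in[t_0,t_1].$$ For every such $B$ and every $\varepsilon\in\bigl(0,(m(t_1-t_0))^{1/p}/2\bigr)$ there is a neural network $\Phi_\varepsilon^X\in\mathcal N_{1,m}$ such that $$\|R_\sigma(\Phi_\varepsilon^X)-X\|_{L^p([t_0,t_1])}<\varepsilon,\qquad \sup_{t\in\mathbb R}\max_{1\le j\le m}|R_\sigma(\Phi_\varepsilon^X)_j(t)|\le K,$$ $$\operatorname{Depth}(\Phi_\varepsilon^X)\le(2+\lceil\log_2(k+1)\rceil)(12+k),\qquad \operatorname{Size}(\Phi_\varepsilon^X)\le m\,c\left(\frac{\varepsilon}{(t_1-t_0)^{1/p}}\right)^{-\frac1{k+1}}.$$ Here $K=K(B)$ depends only on $B$, and $c=c_0\,m^{1+\frac{1}{p(k+1)}}$ with a constant $c_0=c_0(k,B)>0$ that depends only on $k$ and $B$. -/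

import Mathlib

open Set

/-- Neural networks `((W¹, b¹), …, (W^L, b^L))`, `L ≥ 1`, with input dimension `d` and output
dimension `s`: the matrices `W^ℓ` are `n_ℓ × n_{ℓ-1}`, the vectors `b^ℓ` lie in `ℝ^{n_ℓ}`, with
`n_0 = d`, `n_L = s` and arbitrary hidden dimensions. `output W b` is the one-layer network
`((W, b))`, and `layer W b Φ` puts the tuple `(W, b)` in front of `Φ`. -/
inductive NeuralNetwork : ℕ → ℕ → Type
  | output {d s : ℕ} (W : Matrix (Fin s) (Fin d) ℝ) (b : Fin s → ℝ) : NeuralNetwork d s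
  | layer {d n s : ℕ} (W : Matrix (Fin n) (Fin d) ℝ) (b : Fin n → ℝ)
      (Φ : NeuralNetwork n s) : NeuralNetwork d s

namespace NeuralNetwork

/-- The realisation `A_L ∘ σ ∘ A_{L-1} ∘ ⋯ ∘ σ ∘ A_1` with `A_ℓ x = W^ℓ x + b^ℓ`, the activation
function `σ` acting on each coordinate. -/
def realize (σ : ℝ → ℝ) : {d s : ℕ} → NeuralNetwork d s → (Fin d → ℝ) → (Fin s → ℝ)
  | _, _, output W b, x => W.mulVec x + b
  | _, _, layer W b Φ, x => Φ.realize σ (fun i => σ ((W.mulVec x + b) i))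

/-- The number `L` of layers. -/
def depth : {d s : ℕ} → NeuralNetwork d s → ℕ
  | _, _, output _ _ => 1
  | _, _, layer _ _ Φ => Φ.depth + 1

/-- The size `∑_{ℓ=1}^L (n_{ℓ-1} + 1) n_ℓ`. -/
def size : {d s : ℕ} → NeuralNetwork d s → ℕ
  | d, s, output _ _ => (d + 1) * s
  | d, _, layer (n := n) _ _ Φ => (d + 1) * n + Φ.size

end NeuralNetwork

/-- The activation function `x ↦ max(x, 0)`. -/
noncomputable def relu (x : ℝ) : ℝ := max x 0

/-- `X` is a solution on `[t₀, t₁]` of the Cauchy problem `X' = f(t, X)`, `X(t₀) = x₀`, with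
one-sided derivatives at the end points. -/
def IsCauchySolution {m : ℕ} (t₀ t₁ : ℝ) (f : ℝ → (Fin m → ℝ) → (Fin m → ℝ)) (x₀ : Fin m → ℝ)
    (X : ℝ → Fin m → ℝ) : Prop :=
  X t₀ = x₀ ∧ ∀ t ∈ Icc t₀ t₁, HasDerivWithinAt X (f t (X t)) (Icc t₀ t₁) t

/-- The `L^p([t₀, t₁]; ℝ^m)` (quasi-)norm `(∑_j ∫ |g_j(t)|^p dt)^{1/p}`, `ℝ^m` carrying the `ℓ^p`
(quasi-)norm. It is applied only to functions that are continuous on `[t₀, t₁]`. -/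
noncomputable def lpNormOn {m : ℕ} (p t₀ t₁ : ℝ) (g : ℝ → Fin m → ℝ) : ℝ :=
  (∑ j, ∫ t in t₀..t₁, |g t j| ^ p) ^ (1 / p)

/-- `B` bounds the derivatives of orders `0, …, n`, in every coordinate, of the rescaled function
`Y(x) = X(t₀ + (x + 1/2)(t₁ - t₀))` on `[-1/2, 1/2]`; these are `(t₁ - t₀)^j X^{(j)}`.
(The norm on `Fin m → ℝ` is the maximum norm.) -/
def RescaledDerivBound {m : ℕ} (n : ℕ) (t₀ t₁ : ℝ) (X : ℝ → Fin m → ℝ) (B : ℝ) : Prop :=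
  ∀ j ≤ n, ∀ t ∈ Icc t₀ t₁, (t₁ - t₀) ^ j * ‖iteratedDerivWithin j X (Icc t₀ t₁) t‖ ≤ B

/-! Existence comes from Picard–Lindelöf once the space argument of `f` is truncated to a ball in
which Grönwall's inequality confines the solution. Reading `X' = f(t, X)` as a gain of one
derivative gives `X ∈ C^{k+1}`.

For the approximation, rescale time to `b ∈ [0, 1)` and cut it into `w²` cells, each carrying the
order-`k` Taylor polynomial of `X` at its left end. Evaluating that polynomial needs no
multiplication: moving the centre by a fixed `δ` is linear in the coefficients
(`coeff_taylor_eq_sum`), and at centre `τ` the constant coefficient is the value at `τ`. The network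
looks up the coefficients for the cell (`exists_isReLUNet_table`), then reads `2k` further base-`w`
digits of `b`, each selecting one of `w` fixed shifts (`exists_isReLUNet_refine`, iterated in
`exists_isReLUNet_tower`). At the end `b - τ ≤ w^{-2(k+1)}`, the same order as the Taylor error on a
cell of length `w⁻²`. For fixed `k` and `m` the size is `O(w²)`, so an error `δ` costs
`O(δ^{-1/(k+1)})`.

Digits depend discontinuously on `b`, so the jumps are replaced by ramps of slope `M`. At each fixed
time in `[t₀, t₁)` the output is exact for large `M`, and clipping to `[-B, B]` permits dominated
convergence (`eventually_lpNormOn_lt`). Size counts dimensions, not weights, so a large `M` is free.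
-/

/-! ### Affine maps and composition of networks. -/

/-- `g` is an affine function of finitely many real variables. -/
def IsAffineFun {ι : Type} [Fintype ι] (g : (ι → ℝ) → ℝ) : Prop :=
  ∃ (a : ι → ℝ) (b : ℝ), ∀ x, g x = ∑ i, a i * x i + b

namespace IsAffineFun

variable {ι : Type} [Fintype ι] {g g' : (ι → ℝ) → ℝ}

theorem const (c : ℝ) : IsAffineFun (fun _ : ι → ℝ => c) := ⟨0, c, fun x => by simp⟩

theorem coord (i : ι) : IsAffineFun (fun x : ι → ℝ => x i) := by
  classical
  exact ⟨Pi.single i 1, 0, fun x => by simp [Pi.single_apply]⟩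

theorem add (h : IsAffineFun g) (h' : IsAffineFun g') : IsAffineFun (fun x => g x + g' x) := by
  obtain ⟨a, b, hg⟩ := h
  obtain ⟨a', b', hg'⟩ := h'
  refine ⟨a + a', b + b', fun x => ?_⟩
  simp only [hg, hg', Pi.add_apply, add_mul, Finset.sum_add_distrib]
  ring

theorem const_mul (c : ℝ) (h : IsAffineFun g) : IsAffineFun (fun x => c * g x) := by
  obtain ⟨a, b, hg⟩ := h
  refine ⟨fun i => c * a i, c * b, fun x => ?_⟩
  simp only [hg, mul_add, Finset.mul_sum, mul_assoc]

theorem sub (h : IsAffineFun g) (h' : IsAffineFun g') : IsAffineFun (fun x => g x - g' x) := by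
  simpa [sub_eq_add_neg] using h.add (h'.const_mul (-1))

theorem sum {α : Type} (s : Finset α) {G : α → (ι → ℝ) → ℝ} (h : ∀ r, IsAffineFun (G r)) :
    IsAffineFun (fun x => ∑ r ∈ s, G r x) := by
  classical
  induction s using Finset.induction_on with
  | empty => simpa using const 0
  | insert a s ha ih => simpa [Finset.sum_insert ha] using (h a).add ih

theorem comp {κ : Type} [Fintype κ] {F : (κ → ℝ) → (ι → ℝ)} (h : IsAffineFun g)
    (hF : ∀ i, IsAffineFun (fun x => F x i)) : IsAffineFun (fun x => g (F x)) := by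
  obtain ⟨a, b, hg⟩ := h
  simp only [hg]
  exact (sum _ fun i => (hF i).const_mul (a i)).add (const b)

end IsAffineFun

namespace NeuralNetwork

/-- The network which applies `Φ`, then the activation function, then `Ψ`. -/
def append : {d n s : ℕ} → NeuralNetwork d n → NeuralNetwork n s → NeuralNetwork d s
  | _, _, _, output W b, Ψ => layer W b Ψ
  | _, _, _, layer W b Φ, Ψ => layer W b (Φ.append Ψ)

theorem realize_append (σ : ℝ → ℝ) {d n s : ℕ} (Φ : NeuralNetwork d n) (Ψ : NeuralNetwork n s)
    (x : Fin d → ℝ) :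
    (Φ.append Ψ).realize σ x = Ψ.realize σ (fun i => σ (Φ.realize σ x i)) := by
  induction Φ with
  | output W b => rfl
  | layer W b Φ ih => exact ih Ψ _

theorem depth_append {d n s : ℕ} (Φ : NeuralNetwork d n) (Ψ : NeuralNetwork n s) :
    (Φ.append Ψ).depth = Φ.depth + Ψ.depth := by
  induction Φ with
  | output W b => simp [append, depth, add_comm]
  | layer W b Φ ih => simp only [append, depth, ih]; ring

theorem size_append {d n s : ℕ} (Φ : NeuralNetwork d n) (Ψ : NeuralNetwork n s) :
    (Φ.append Ψ).size = Φ.size + Ψ.size := by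
  induction Φ with
  | output W b => simp [append, size]
  | layer W b Φ ih => simp only [append, size, ih]; ring

end NeuralNetwork

theorem relu_of_nonneg {x : ℝ} (h : 0 ≤ x) : relu x = x := max_eq_left h

theorem relu_of_nonpos {x : ℝ} (h : x ≤ 0) : relu x = 0 := max_eq_right h

theorem continuous_relu : Continuous relu := continuous_id.max continuous_const

theorem NeuralNetwork.continuous_realize {σ : ℝ → ℝ} (hσ : Continuous σ) {d s : ℕ}
    (Φ : NeuralNetwork d s) : Continuous (Φ.realize σ) := by
  induction Φ with
  | output W b =>
    exact (Continuous.matrix_mulVec continuous_const continuous_id).add continuous_const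
  | layer W b Φ ih =>
    refine ih.comp (continuous_pi fun i => hσ.comp ?_)
    exact (continuous_apply i).comp
      ((Continuous.matrix_mulVec continuous_const continuous_id).add continuous_const)

/-- `F` is the realisation of a ReLU network of depth `L` and size `S`, whichever way its
coordinates are enumerated. -/
def IsReLUNet {ι κ : Type} (F : (ι → ℝ) → (κ → ℝ)) (L S : ℕ) : Prop :=
  ∀ ⦃d s : ℕ⦄ (e : ι ≃ Fin d) (e' : κ ≃ Fin s), ∃ Φ : NeuralNetwork d s,
    Φ.depth = L ∧ Φ.size = S ∧ ∀ x k, Φ.realize relu (x ∘ e.symm) (e' k) = F x k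

namespace IsReLUNet

theorem affine {ι κ : Type} [Fintype ι] [Fintype κ] {F : (ι → ℝ) → (κ → ℝ)}
    (h : ∀ k, IsAffineFun (fun x => F x k)) :
    IsReLUNet F 1 ((Fintype.card ι + 1) * Fintype.card κ) := by
  intro d s e e'
  choose a b hF using h
  refine ⟨.output (fun k i => a (e'.symm k) (e.symm i)) (fun k => b (e'.symm k)), rfl, ?_, ?_⟩
  · simp [NeuralNetwork.size, Fintype.card_congr e, Fintype.card_congr e']
  · intro x k
    simp only [NeuralNetwork.realize, Pi.add_apply, Matrix.mulVec, dotProduct, hF,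
      Equiv.symm_apply_apply, Function.comp]
    rw [Equiv.sum_comp e.symm (fun i => a k i * x i)]

theorem comp {ι κ μ : Type} [Fintype κ] {F : (ι → ℝ) → (κ → ℝ)} {G : (κ → ℝ) → (μ → ℝ)}
    {L S L' S' : ℕ} (hG : IsReLUNet G L' S') (hF : IsReLUNet F L S) :
    IsReLUNet (fun x => G (fun k => relu (F x k))) (L + L') (S + S') := by
  intro d s e e'
  obtain ⟨Φ, h1, h2, h3⟩ := hF e (Fintype.equivFin κ)
  obtain ⟨Ψ, k1, k2, k3⟩ := hG (Fintype.equivFin κ) e'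
  refine ⟨Φ.append Ψ, by rw [Φ.depth_append, h1, k1], by rw [Φ.size_append, h2, k2], ?_⟩
  intro x k
  change _ = G (fun k => relu (F x k)) k
  rw [Φ.realize_append, ← k3]
  congr 1
  funext i
  simp [← h3]

end IsReLUNet

/-! ### Cell indicators from steep ramps. -/

/-- A continuous piecewise linear approximation, exact for large `M`, of the jump at `a`. -/
noncomputable def reluStep (M : ℕ) (a h : ℝ) : ℝ := relu (M * (h - a) + 1) - relu (M * (h - a))

/-- The ramp climbs on `[a - 1/M, a]`, to the left of the jump, so the value at `a` itself is
already 1. This is what makes the cells half-open and compatible with the floor function. -/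
theorem eventually_reluStep_eq (a h : ℝ) :
    ∀ᶠ M : ℕ in Filter.atTop, reluStep M a h = if a ≤ h then 1 else 0 := by
  by_cases hah : a ≤ h
  · refine Filter.Eventually.of_forall fun M => ?_
    have : 0 ≤ (M : ℝ) * (h - a) := mul_nonneg M.cast_nonneg (sub_nonneg.2 hah)
    rw [reluStep, relu_of_nonneg this, relu_of_nonneg (by linarith), if_pos hah]
    ring
  · rw [not_le] at hah
    filter_upwards [Filter.eventually_ge_atTop ⌈1 / (a - h)⌉₊] with M hM
    have h1 : 1 / (a - h) ≤ M := Nat.ceil_le.1 hM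
    rw [div_le_iff₀ (sub_pos.2 hah)] at h1
    rw [reluStep, relu_of_nonpos (by nlinarith), relu_of_nonpos (by nlinarith),
      if_neg (not_le.2 hah), sub_zero]

/-- The four affine functions of `h` from which the indicator of the cell `[r/w, (r+1)/w)` is
built. -/
noncomputable def cellKnot (w M : ℕ) (p : Fin w × Fin 4) (h : ℝ) : ℝ :=
  ![M * (h - (p.1 : ℕ) / w) + 1, M * (h - (p.1 : ℕ) / w),
    M * (h - ((p.1 : ℕ) + 1) / w) + 1, M * (h - ((p.1 : ℕ) + 1) / w)] p.2

/-- The linear combination of the rectified knots which gives the indicator of the cell `r`. -/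
def cellComb {w : ℕ} (y : Fin w × Fin 4 → ℝ) (r : Fin w) : ℝ :=
  y (r, 0) - y (r, 1) - (y (r, 2) - y (r, 3))

theorem eventually_cellComb_eq {w : ℕ} {h : ℝ} (hh : 0 ≤ h) (r : Fin w)
    (hr : (r : ℕ) = ⌊w * h⌋₊) :
    ∀ᶠ M : ℕ in Filter.atTop, ∀ q : Fin w,
      cellComb (fun p => relu (cellKnot w M p h)) q = if q = r then 1 else 0 := by
  rw [Filter.eventually_all]
  intro q
  have hw : (0 : ℝ) < w := by exact_mod_cast q.pos
  filter_upwards [eventually_reluStep_eq ((q : ℕ) / w) h,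
    eventually_reluStep_eq (((q : ℕ) + 1) / w) h] with M h1 h2
  have e : cellComb (fun p => relu (cellKnot w M p h)) q =
      reluStep M ((q : ℕ) / w) h - reluStep M (((q : ℕ) + 1) / w) h := rfl
  have key : ∀ n : ℕ, ((n : ℝ) / w ≤ h ↔ n ≤ (r : ℕ)) := fun n => by
    rw [div_le_iff₀ hw, hr, Nat.le_floor_iff (by positivity), mul_comm]
  have k2 := key (q + 1)
  push_cast at k2
  rw [e, h1, h2]
  simp only [key, k2, Fin.ext_iff]
  split_ifs <;> first | omega | norm_num

theorem isAffineFun_cellKnot {ι : Type} [Fintype ι] {g : (ι → ℝ) → ℝ} (hg : IsAffineFun g)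
    {w : ℕ} (M : ℕ) (p : Fin w × Fin 4) : IsAffineFun (fun x => cellKnot w M p (g x)) := by
  have h0 : ∀ a : ℝ, IsAffineFun (fun x => (M : ℝ) * (g x - a)) := fun a =>
    (hg.sub (.const a)).const_mul _
  obtain ⟨r, i⟩ := p
  fin_cases i
  · exact (h0 _).add (.const 1)
  · exact h0 _
  · exact (h0 _).add (.const 1)
  · exact h0 _

theorem isAffineFun_cellComb {ι : Type} [Fintype ι] {w : ℕ} (f : Fin w × Fin 4 → ι) (r : Fin w) :
    IsAffineFun (fun y : ι → ℝ => cellComb (fun p => y (f p)) r) :=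
  ((IsAffineFun.coord _).sub (.coord _)).sub ((IsAffineFun.coord _).sub (.coord _))

/-! ### Building blocks: table, change of centre, clipping, and their iteration. -/

/-- A number `h` and a vector `v`, shifted by `A`, as a single vector. -/
def encode {S : Type} (A h : ℝ) (v : S → ℝ) : Option S → ℝ := fun o => o.elim h (fun s => v s + A)

/-- The shift by `A` makes every entry nonnegative, so the activation between two composed blocks
acts as the identity. -/
theorem relu_encode {S : Type} {A h : ℝ} {v : S → ℝ} (hh : 0 ≤ h) (hv : ∀ s, |v s| ≤ A) :
    (fun o => relu (encode A h v o)) = encode A h v := by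
  funext o
  refine relu_of_nonneg ?_
  cases o with
  | none => exact hh
  | some s => simpa [encode] using neg_le_iff_add_nonneg.1 (neg_le_of_abs_le (hv s))

/-- With the cell indicators in the hidden layer, both the stored vector and the cell index are
linear combinations of them; subtracting the index from `N * (α * x 0 + β)` leaves the fractional
part for later digits. -/
theorem exists_isReLUNet_table {S : Type} [Fintype S] (A α β : ℝ) {N : ℕ} (V : Fin N → S → ℝ) :
    ∃ F : ℕ → (Fin 1 → ℝ) → (Option S → ℝ),
      (∀ M, IsReLUNet (F M) 2
        (2 * (4 * N + 1) + (4 * N + 2) * (Fintype.card S + 1))) ∧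
      ∀ x : Fin 1 → ℝ, 0 ≤ α * x 0 + β → ∀ r : Fin N, (r : ℕ) = ⌊N * (α * x 0 + β)⌋₊ →
        ∀ᶠ M in Filter.atTop, F M x = encode A (N * (α * x 0 + β) - (r : ℕ)) (V r) := by
  have hφ : IsAffineFun (fun x : Fin 1 → ℝ => α * x 0 + β) :=
    ((IsAffineFun.coord 0).const_mul α).add (.const β)
  let hid : ℕ → (Fin 1 → ℝ) → ((Fin N × Fin 4) ⊕ Unit → ℝ) := fun M x =>
    Sum.elim (fun p => cellKnot N M p (α * x 0 + β)) (fun _ => α * x 0 + β)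
  let out : ((Fin N × Fin 4) ⊕ Unit → ℝ) → (Option S → ℝ) := fun y o =>
    o.elim (N * y (.inr ()) - ∑ r : Fin N, (r : ℕ) * cellComb (fun p => y (.inl p)) r)
      (fun s => (∑ r : Fin N, V r s * cellComb (fun p => y (.inl p)) r) + A)
  have hhid : ∀ M k, IsAffineFun (fun x => hid M x k) := by
    rintro M (p | _)
    · exact isAffineFun_cellKnot hφ M p
    · exact hφ
  have hout : ∀ k, IsAffineFun (fun y => out y k) := by
    rintro (_ | s)
    · exact ((IsAffineFun.coord _).const_mul _).sub
        (.sum _ fun r => (isAffineFun_cellComb _ r).const_mul _)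
    · exact (IsAffineFun.sum _ fun r => (isAffineFun_cellComb _ r).const_mul _).add (.const A)
  refine ⟨fun M x => out (fun k => relu (hid M x k)), fun M => ?_, fun x hx r hr => ?_⟩
  · convert (IsReLUNet.affine hout).comp (IsReLUNet.affine (hhid M)) using 1
    simp
    ring
  · filter_upwards [eventually_cellComb_eq hx r hr] with M hM
    have e : ∀ q, cellComb (fun p => relu (hid M x (.inl p))) q = if q = r then 1 else 0 := hM
    funext o
    cases o with
    | none =>
      change N * relu (α * x 0 + β) - ∑ q : Fin N, (q : ℕ) * cellComb _ q = _
      simp only [e, relu_of_nonneg hx]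
      simp [encode]
    | some s =>
      change (∑ q : Fin N, V q s * cellComb _ q) + A = _
      simp only [e]
      simp [encode]

/-- The product of an indicator with `T q v` is avoided by a gate: `relu (T q v + 2A * 1_q - A)`
equals `T q v + A` for the selected `q` and vanishes for the others, because `|T q v| ≤ A`. Summing
over `q` gives the selected vector, already shifted by `A`. -/
theorem exists_isReLUNet_refine {S : Type} [Fintype S] (A : ℝ) {w : ℕ}
    (T : Fin w → (S → ℝ) → (S → ℝ)) (hT : ∀ r s, IsAffineFun (fun v => T r v s)) :
    ∃ F : ℕ → (Option S → ℝ) → (Option S → ℝ),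
      (∀ M, IsReLUNet (F M) 3
        ((Fintype.card S + 2) * (4 * w + Fintype.card S + 1) +
          (4 * w + Fintype.card S + 2) * (w * Fintype.card S + 1) +
          (w * Fintype.card S + 2) * (Fintype.card S + 1))) ∧
      ∀ (h : ℝ) (v : S → ℝ), 0 ≤ h → (∀ s, |v s| ≤ A) → (∀ r s, |T r v s| ≤ A) →
        ∀ r : Fin w, (r : ℕ) = ⌊w * h⌋₊ →
          ∀ᶠ M in Filter.atTop, F M (encode A h v) = encode A (w * h - (r : ℕ)) (T r v) := by
  let hid : ℕ → (Option S → ℝ) → ((Fin w × Fin 4) ⊕ Option S → ℝ) := fun M x =>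
    Sum.elim (fun p => cellKnot w M p (x none)) (fun o => x o)
  let gate : ((Fin w × Fin 4) ⊕ Option S → ℝ) → ((Fin w × S) ⊕ Unit → ℝ) := fun y =>
    Sum.elim
      (fun q => T q.1 (fun s => y (.inr (some s)) - A) q.2 +
        ((2 * A) * cellComb (fun p => y (.inl p)) q.1 - A))
      (fun _ => w * y (.inr none) - ∑ r : Fin w, (r : ℕ) * cellComb (fun p => y (.inl p)) r)
  let out : ((Fin w × S) ⊕ Unit → ℝ) → (Option S → ℝ) := fun z o =>
    o.elim (z (.inr ())) (fun s => ∑ r : Fin w, z (.inl (r, s)))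
  have hhid : ∀ M k, IsAffineFun (fun x => hid M x k) := by
    rintro M (p | _)
    · exact isAffineFun_cellKnot (.coord none) M p
    · exact .coord _
  have hgate : ∀ k, IsAffineFun (fun y => gate y k) := by
    rintro (⟨r, s⟩ | _)
    · refine IsAffineFun.add ?_ (((isAffineFun_cellComb _ r).const_mul _).sub (.const A))
      exact (hT r s).comp fun i => (IsAffineFun.coord _).sub (.const A)
    · exact ((IsAffineFun.coord _).const_mul _).sub
        (.sum _ fun r => (isAffineFun_cellComb _ r).const_mul _)
  have hout : ∀ k, IsAffineFun (fun z => out z k) := by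
    rintro (_ | s)
    · exact .coord _
    · exact IsAffineFun.sum _ fun r => .coord _
  refine ⟨fun M x => out (fun k => relu (gate (fun k => relu (hid M x k)) k)), fun M => ?_,
    fun h v hh hv hTv r hr => ?_⟩
  · convert (IsReLUNet.affine hout).comp
      ((IsReLUNet.affine hgate).comp (IsReLUNet.affine (hhid M))) using 1
    simp
    ring
  · filter_upwards [eventually_cellComb_eq hh r hr] with M hM
    have e : ∀ q, cellComb (fun p => relu (hid M (encode A h v) (.inl p))) q =
        if q = r then 1 else 0 := hM
    have e' : ∀ o, relu (hid M (encode A h v) (.inr o)) = encode A h v o :=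
      congrFun (relu_encode hh hv)
    have hr' : ((r : ℕ) : ℝ) ≤ w * h := by
      rw [hr]; exact Nat.floor_le (by positivity)
    funext o
    cases o with
    | none =>
      change relu (w * relu (hid M (encode A h v) (.inr none)) -
        ∑ q : Fin w, (q : ℕ) * cellComb _ q) = _
      simp only [e, e']
      simp [encode, relu_of_nonneg (sub_nonneg.2 hr')]
    | some s =>
      change (∑ q : Fin w, relu (T q (fun s => relu (hid M (encode A h v) (.inr (some s))) - A) s +
        ((2 * A) * cellComb _ q - A))) = _
      simp only [e, e']
      have e3 : (fun s => encode A h v (some s) - A) = v := by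
        funext s; simp [encode]
      rw [e3, Finset.sum_eq_single r]
      · rw [if_pos rfl, relu_of_nonneg]
        · simp [encode]; ring
        · linarith [neg_le_of_abs_le (hTv r s)]
      · intro q _ hq
        rw [if_neg hq, relu_of_nonpos]
        linarith [le_of_abs_le (hTv q s)]
      · simp

/-- The bound by `B` holds for every input, hence also at times outside `[t₀, t₁]` and on the ramps,
where the preceding blocks give no control. -/
theorem exists_isReLUNet_clip {S : Type} [Fintype S] (A : ℝ) {B : ℝ} (hB : 0 ≤ B) {m : ℕ}
    (sel : Fin m → S) :
    ∃ F : (Option S → ℝ) → (Fin m → ℝ),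
      IsReLUNet F 2 ((Fintype.card S + 2) * (2 * m) + (2 * m + 1) * m) ∧
      (∀ h v j, F (encode A h v) j = max (-B) (min B (v (sel j)))) ∧ ∀ x j, |F x j| ≤ B := by
  let hid : (Option S → ℝ) → (Fin m ⊕ Fin m → ℝ) := fun x =>
    Sum.elim (fun j => x (some (sel j)) - A + B) (fun j => x (some (sel j)) - A - B)
  let out : (Fin m ⊕ Fin m → ℝ) → (Fin m → ℝ) := fun y j => y (.inl j) - y (.inr j) - B
  have hhid : ∀ k, IsAffineFun (fun x => hid x k) := by
    rintro (j | j)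
    · exact ((IsAffineFun.coord _).sub (.const A)).add (.const B)
    · exact ((IsAffineFun.coord _).sub (.const A)).sub (.const B)
  have hout : ∀ k, IsAffineFun (fun y => out y k) := fun k =>
    ((IsAffineFun.coord _).sub (.coord _)).sub (.const B)
  have key : ∀ u : ℝ, relu (u + B) - relu (u - B) - B = max (-B) (min B u) := by
    intro u
    rcases le_total u (-B) with h | h
    · rw [relu_of_nonpos (by linarith), relu_of_nonpos (by linarith), min_eq_right (by linarith),
        max_eq_left h]
      ring
    · rcases le_total u B with h' | h'
      · rw [relu_of_nonneg (by linarith), relu_of_nonpos (by linarith), min_eq_right h',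
          max_eq_right h]
        ring
      · rw [relu_of_nonneg (by linarith), relu_of_nonneg (by linarith), min_eq_left h',
          max_eq_right (by linarith)]
        ring
  have hF : ∀ x j, out (fun k => relu (hid x k)) j = max (-B) (min B (x (some (sel j)) - A)) :=
    fun x j => key _
  refine ⟨fun x => out (fun k => relu (hid x k)), ?_, fun h v j => ?_, fun x j => ?_⟩
  · convert (IsReLUNet.affine hout).comp (IsReLUNet.affine hhid) using 1
    simp
    ring
  · exact (hF _ j).trans (by simp [encode])
  · change |out (fun k => relu (hid x k)) j| ≤ B
    rw [hF, abs_le]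
    exact ⟨le_max_left _ _, max_le (by linarith) (min_le_left _ _)⟩

/-- The invariant is that the position equals `τ + h / (N * w ^ L)` with `h ∈ [0, 1)`: `τ` collects
the digits read so far and `h` is the unread tail. One more stage moves the next digit from `h` to
`τ`. -/
theorem exists_isReLUNet_tower {S : Type} [Fintype S] {A : ℝ} (α β : ℝ) {N w : ℕ} (hN : 0 < N)
    (hw : 0 < w) (V : Fin N → ℝ → S → ℝ) (hV : ∀ ν, ∀ τ ∈ Icc (0 : ℝ) 2, ∀ s, |V ν τ s| ≤ A)
    (T : ℝ → (S → ℝ) → (S → ℝ)) (hT : ∀ δ s, IsAffineFun (fun v => T δ v s))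
    (hTV : ∀ ν τ δ, T δ (V ν τ) = V ν (τ + δ)) (L : ℕ) :
    ∃ F : ℕ → (Fin 1 → ℝ) → (Option S → ℝ),
      (∀ M, IsReLUNet (F M) (2 + 3 * L)
        (2 * (4 * N + 1) + (4 * N + 2) * (Fintype.card S + 1) +
          L * ((Fintype.card S + 2) * (4 * w + Fintype.card S + 1) +
          (4 * w + Fintype.card S + 2) * (w * Fintype.card S + 1) +
          (w * Fintype.card S + 2) * (Fintype.card S + 1)))) ∧
      ∀ x : Fin 1 → ℝ, 0 ≤ α * x 0 + β → α * x 0 + β < 1 →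
        ∃ (ν : Fin N) (τ h : ℝ), ((ν : ℕ) : ℝ) / N ≤ τ ∧ α * x 0 + β < (((ν : ℕ) : ℝ) + 1) / N ∧
          0 ≤ h ∧ h < 1 ∧ α * x 0 + β = τ + h / (N * w ^ L) ∧
          ∀ᶠ M in Filter.atTop, F M x = encode A h (V ν τ) := by
  have hN' : (0 : ℝ) < N := by exact_mod_cast hN
  have hw' : (0 : ℝ) < w := by exact_mod_cast hw
  induction L with
  | zero =>
    obtain ⟨F, hF, hF'⟩ := exists_isReLUNet_table A α β (fun ν : Fin N => V ν ((ν : ℕ) / N))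
    refine ⟨F, by simpa using hF, fun x hx0 hx1 => ?_⟩
    have hfl : ⌊N * (α * x 0 + β)⌋₊ < N := by
      rw [Nat.floor_lt (by positivity)]
      nlinarith
    have h1 := Nat.floor_le (a := N * (α * x 0 + β)) (by positivity)
    have h2 := Nat.lt_floor_add_one (N * (α * x 0 + β))
    refine ⟨⟨_, hfl⟩, (⌊N * (α * x 0 + β)⌋₊ : ℝ) / N, N * (α * x 0 + β) - ⌊N * (α * x 0 + β)⌋₊,
      le_rfl, ?_, by linarith, by linarith, ?_, hF' x hx0 ⟨_, hfl⟩ rfl⟩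
    · rw [lt_div_iff₀ hN']; simpa [mul_comm] using h2
    · field_simp
      ring
  | succ L ih =>
    obtain ⟨F, hF, hF'⟩ := ih
    obtain ⟨G, hG, hG'⟩ := exists_isReLUNet_refine A
      (fun r : Fin w => T ((r : ℕ) / (N * w ^ (L + 1)))) (fun r s => hT _ s)
    refine ⟨fun M x => G M (fun k => relu (F M x k)), fun M => ?_, fun x hx0 hx1 => ?_⟩
    · convert (hG M).comp (hF M) using 1
      all_goals ring
    · obtain ⟨ν, τ, h, h1, h2, h3, h4, h5, h6⟩ := hF' x hx0 hx1
      have hD : (1 : ℝ) ≤ N * w ^ (L + 1) := by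
        exact_mod_cast Nat.succ_le_of_lt (Nat.mul_pos hN (pow_pos hw _))
      have hD0 : (0 : ℝ) < N * w ^ L := by positivity
      have hfl : ⌊w * h⌋₊ < w := by
        rw [Nat.floor_lt (by positivity)]
        nlinarith
      have g1 := Nat.floor_le (a := w * h) (by positivity)
      have g2 := Nat.lt_floor_add_one (w * h)
      have hτ0 : 0 ≤ τ := le_trans (by positivity) h1
      have hτ1 : τ ≤ 1 := by
        have : 0 ≤ h / (N * w ^ L) := by positivity
        linarith
      have hv : ∀ s, |V ν τ s| ≤ A := hV ν τ ⟨hτ0, by linarith⟩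
      refine ⟨ν, τ + (⌊w * h⌋₊ : ℝ) / (N * w ^ (L + 1)), w * h - ⌊w * h⌋₊, ?_, h2, by linarith,
        by linarith, ?_, ?_⟩
      · exact h1.trans (le_add_of_nonneg_right (by positivity))
      · rw [h5]
        field_simp
        ring
      · have hg := hG' h (V ν τ) h3 hv (fun r s => ?_) ⟨_, hfl⟩ rfl
        · filter_upwards [h6, hg] with M e1 e2
          rw [e1, relu_encode h3 hv, e2, hTV]
        · rw [hTV]
          -- The gate needs a bound for all `w` shifts, not only the selected one. An unselected
          -- shift can carry the centre beyond 1, which is why `V` is bounded on `[0, 2]`.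
          have : ((r : ℕ) : ℝ) / (N * w ^ (L + 1)) ≤ 1 := by
            rw [div_le_one (by linarith)]
            have h8 : ((r : ℕ) : ℝ) ≤ w := by exact_mod_cast r.2.le
            have h9 : (1 : ℝ) ≤ N * w ^ L := by
              exact_mod_cast Nat.succ_le_of_lt (Nat.mul_pos hN (pow_pos hw _))
            rw [pow_succ]
            nlinarith
          refine hV ν _ ⟨by positivity, by linarith⟩ s

/-! ### The Cauchy problem: existence, uniqueness, regularity. -/

/-- The coordinatewise truncation of a vector to `[-R, R]`. -/
noncomputable def clampVec {m : ℕ} (R : ℝ) (x : Fin m → ℝ) : Fin m → ℝ :=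
  fun i => max (-R) (min R (x i))

theorem lipschitzWith_clampVec {m : ℕ} (R : ℝ) :
    LipschitzWith 1 (clampVec R : (Fin m → ℝ) → (Fin m → ℝ)) := by
  refine LipschitzWith.of_dist_le_mul fun x y => ?_
  rw [NNReal.coe_one, one_mul, dist_pi_le_iff dist_nonneg]
  intro i
  refine le_trans ?_ (dist_le_pi_dist x y i)
  exact ((LipschitzWith.id.const_min R).const_max (-R)).dist_le_mul (x i) (y i) |>.trans (by simp)

theorem clampVec_eq_self {m : ℕ} {R : ℝ} {x : Fin m → ℝ} (h : ‖x‖ ≤ R) : clampVec R x = x := by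
  funext i
  have := abs_le.1 ((norm_le_pi_norm x i).trans h)
  rw [clampVec, min_eq_right this.2, max_eq_right this.1]

theorem norm_clampVec_le {m : ℕ} {R : ℝ} (hR : 0 ≤ R) (x : Fin m → ℝ) : ‖clampVec R x‖ ≤ R := by
  rw [pi_norm_le_iff_of_nonneg hR]
  intro i
  rw [Real.norm_eq_abs, abs_le]
  exact ⟨le_max_left _ _, max_le (by linarith) (min_le_left _ _)⟩

theorem norm_clampVec_le_norm {m : ℕ} {R : ℝ} (hR : 0 ≤ R) (x : Fin m → ℝ) :
    ‖clampVec R x‖ ≤ ‖x‖ := by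
  have h0 : clampVec R (0 : Fin m → ℝ) = 0 := clampVec_eq_self (by simpa using hR)
  simpa [h0, dist_zero_right] using (lipschitzWith_clampVec R).dist_le_mul x 0

section Cauchy

variable {m : ℕ} {t₀ t₁ : ℝ} {f : ℝ → (Fin m → ℝ) → (Fin m → ℝ)} {x₀ : Fin m → ℝ}
  {X Y : ℝ → Fin m → ℝ} {Λ : NNReal}

theorem IsCauchySolution.continuousOn (hX : IsCauchySolution t₀ t₁ f x₀ X) :
    ContinuousOn X (Icc t₀ t₁) := fun t ht => (hX.2 t ht).continuousWithinAt

theorem IsCauchySolution.hasDerivWithinAt_Ici (hX : IsCauchySolution t₀ t₁ f x₀ X) {t : ℝ}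
    (ht : t ∈ Ico t₀ t₁) : HasDerivWithinAt X (f t (X t)) (Ici t) t :=
  (hX.2 t (Ico_subset_Icc_self ht)).mono_of_mem_nhdsWithin (Icc_mem_nhdsGE_of_mem ht)

theorem IsCauchySolution.eqOn (hf : ∀ t ∈ Icc t₀ t₁, LipschitzWith Λ (f t))
    (hX : IsCauchySolution t₀ t₁ f x₀ X) (hY : IsCauchySolution t₀ t₁ f x₀ Y) :
    EqOn Y X (Icc t₀ t₁) :=
  ODE_solution_unique_of_mem_Icc_right (v := f) (s := fun _ => univ) (K := Λ)
    (fun t ht => (hf t (Ico_subset_Icc_self ht)).lipschitzOnWith)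
    hY.continuousOn (fun _ ht => hY.hasDerivWithinAt_Ici ht) (fun _ _ => trivial)
    hX.continuousOn (fun _ ht => hX.hasDerivWithinAt_Ici ht) (fun _ _ => trivial)
    (hY.1.trans hX.1.symm)

theorem exists_isCauchySolution (h01 : t₀ ≤ t₁)
    (hc : ContinuousOn (fun z : ℝ × (Fin m → ℝ) => f z.1 z.2) (Icc t₀ t₁ ×ˢ univ))
    (hf : ∀ t ∈ Icc t₀ t₁, LipschitzWith Λ (f t)) :
    ∃ X, IsCauchySolution t₀ t₁ f x₀ X := by
  have hcx : ∀ x, ContinuousOn (fun t => f t x) (Icc t₀ t₁) := fun x =>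
    hc.comp (f := fun t => (t, x)) (by fun_prop) fun t ht => ⟨ht, trivial⟩
  obtain ⟨C, hC⟩ := isCompact_Icc.exists_bound_of_continuousOn (hcx 0)
  have hC0 : 0 ≤ C := (norm_nonneg _).trans (hC t₀ ⟨le_rfl, h01⟩)
  have hgrow : ∀ t ∈ Icc t₀ t₁, ∀ x, ‖f t x‖ ≤ Λ * ‖x‖ + C := fun t ht x => by
    have h1 := (hf t ht).dist_le_mul x 0
    rw [dist_eq_norm, dist_zero_right] at h1
    calc ‖f t x‖ = ‖(f t x - f t 0) + f t 0‖ := by rw [sub_add_cancel]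
      _ ≤ _ := (norm_add_le _ _).trans (add_le_add h1 (hC t ht))
  -- Truncation does not increase the norm, so the truncated field obeys the same linear growth
  -- bound; `R` therefore bounds its solution too, and the truncation at `R` is never active along
  -- it.
  set R : ℝ := gronwallBound ‖x₀‖ Λ C (t₁ - t₀) with hRdef
  have hmono : ∀ t ∈ Icc t₀ t₁, gronwallBound ‖x₀‖ Λ C (t - t₀) ≤ R := fun t ht =>
    gronwallBound_mono (norm_nonneg _) hC0 Λ.2 (by linarith [ht.2])
  have hR : 0 ≤ R := by
    have := hmono t₀ ⟨le_rfl, h01⟩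
    rw [sub_self, gronwallBound_x0] at this
    exact (norm_nonneg _).trans this
  let g : ℝ → (Fin m → ℝ) → (Fin m → ℝ) := fun t x => f t (clampVec R x)
  let D : NNReal := ⟨Λ * R + C, by positivity⟩
  let a : NNReal := ⟨D * (t₁ - t₀), mul_nonneg D.2 (sub_nonneg.2 h01)⟩
  have hg : IsPicardLindelof g (⟨t₀, le_rfl, h01⟩ : Icc t₀ t₁) x₀ a 0 D Λ := by
    refine ⟨fun t ht => ?_, fun x _ => hcx _, fun t ht x _ => ?_, ?_⟩
    · have h1 := (hf t ht).comp (lipschitzWith_clampVec R)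
      rw [mul_one] at h1
      exact h1.lipschitzOnWith
    · exact (hgrow t ht _).trans (add_le_add_left
        (mul_le_mul_of_nonneg_left (norm_clampVec_le hR x) Λ.2) C)
    · have : max (t₁ - t₀) (t₀ - t₀) = t₁ - t₀ := max_eq_left (by linarith)
      simp only [this, NNReal.coe_zero, sub_zero]
      exact le_rfl
  obtain ⟨X, hX0, hX⟩ := hg.exists_eq_forall_mem_Icc_hasDerivWithinAt₀
  have hX' : IsCauchySolution t₀ t₁ g x₀ X := ⟨hX0, hX⟩
  have hb := norm_le_gronwallBound_of_norm_deriv_right_le (δ := ‖x₀‖) (K := Λ) (ε := C)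
    hX'.continuousOn (fun t ht => hX'.hasDerivWithinAt_Ici ht) (by rw [hX'.1]) fun t ht =>
      (hgrow t (Ico_subset_Icc_self ht) _).trans (add_le_add_left
        (mul_le_mul_of_nonneg_left (norm_clampVec_le_norm hR (X t)) Λ.2) C)
  refine ⟨X, hX0, fun t ht => ?_⟩
  have := hX t ht
  rwa [show g t (X t) = f t (X t) by
    simp only [g, clampVec_eq_self ((hb t ht).trans (hmono t ht))]] at this

theorem IsCauchySolution.contDiffOn (h01 : t₀ < t₁) {k : ℕ}
    (hf : ContDiffOn ℝ (k : WithTop ℕ∞) (fun z : ℝ × (Fin m → ℝ) => f z.1 z.2)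
      (Icc t₀ t₁ ×ˢ univ)) (hX : IsCauchySolution t₀ t₁ f x₀ X) :
    ContDiffOn ℝ ((k + 1 : ℕ) : WithTop ℕ∞) X (Icc t₀ t₁) := by
  have hu := uniqueDiffOn_Icc h01
  have step : ∀ j : ℕ, j ≤ k → ContDiffOn ℝ (j : WithTop ℕ∞) X (Icc t₀ t₁) →
      ContDiffOn ℝ ((j + 1 : ℕ) : WithTop ℕ∞) X (Icc t₀ t₁) := by
    intro j hj hXj
    rw [Nat.cast_add, Nat.cast_one, contDiffOn_succ_iff_derivWithin hu]
    refine ⟨fun t ht => (hX.2 t ht).differentiableWithinAt, by simp, ?_⟩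
    have h1 : ContDiffOn ℝ (j : WithTop ℕ∞) (fun t => f t (X t)) (Icc t₀ t₁) :=
      (hf.of_le (by exact_mod_cast hj)).comp (f := fun t => (t, X t))
        (contDiffOn_id.prodMk hXj) fun t ht => ⟨ht, trivial⟩
    exact h1.congr fun t ht => (hX.2 t ht).derivWithin (hu t ht)
  have all : ∀ j : ℕ, j ≤ k + 1 → ContDiffOn ℝ (j : WithTop ℕ∞) X (Icc t₀ t₁) := by
    intro j
    induction j with
    | zero => exact fun _ => by simpa using hX.continuousOn
    | succ j ih => exact fun hj => step j (by omega) (ih (by omega))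
  exact all _ le_rfl

end Cauchy

/-! ### Derivative bounds and Taylor polynomials in rescaled time. -/

theorem exists_rescaledDerivBound {m n : ℕ} {t₀ t₁ : ℝ} (h01 : t₀ < t₁) {X : ℝ → Fin m → ℝ}
    (hX : ContDiffOn ℝ (n : WithTop ℕ∞) X (Icc t₀ t₁)) :
    ∃ B : ℝ, RescaledDerivBound n t₀ t₁ X B := by
  have h : ∀ j : ℕ, ∃ B : ℝ, 0 ≤ B ∧ (j ≤ n → ∀ t ∈ Icc t₀ t₁,
      (t₁ - t₀) ^ j * ‖iteratedDerivWithin j X (Icc t₀ t₁) t‖ ≤ B) := by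
    intro j
    by_cases hj : j ≤ n
    · obtain ⟨C, hC⟩ := isCompact_Icc.exists_bound_of_continuousOn
        (hX.continuousOn_iteratedDerivWithin (by exact_mod_cast hj) (uniqueDiffOn_Icc h01))
      have hC0 := (norm_nonneg _).trans (hC t₀ ⟨le_rfl, h01.le⟩)
      have hT : 0 ≤ (t₁ - t₀) ^ j := pow_nonneg (by linarith) _
      exact ⟨(t₁ - t₀) ^ j * C, mul_nonneg hT hC0,
        fun _ t ht => mul_le_mul_of_nonneg_left (hC t ht) hT⟩
    · exact ⟨0, le_rfl, fun h => absurd h hj⟩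
  choose B hB0 hB using h
  refine ⟨∑ j ∈ Finset.range (n + 1), B j, fun j hj t ht => (hB j hj t ht).trans ?_⟩
  exact Finset.single_le_sum (f := B) (fun i _ => hB0 i) (Finset.mem_range.2 (by omega))

theorem norm_sub_taylorWithinEval_le {m k : ℕ} {t₀ t₁ B : ℝ} (h01 : t₀ < t₁)
    {X : ℝ → Fin m → ℝ} (hX : ContDiffOn ℝ ((k + 1 : ℕ) : WithTop ℕ∞) X (Icc t₀ t₁))
    (hB : RescaledDerivBound (k + 1) t₀ t₁ X B) {a b : ℝ} (ha : 0 ≤ a) (hab : a ≤ b) (hb : b < 1) :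
    ‖X (t₀ + b * (t₁ - t₀)) -
      taylorWithinEval X k (Icc t₀ t₁) (t₀ + a * (t₁ - t₀)) (t₀ + b * (t₁ - t₀))‖
      ≤ B * (b - a) ^ (k + 1) := by
  have hT : 0 < t₁ - t₀ := sub_pos.2 h01
  set T := t₁ - t₀ with hTdef
  set s := t₀ + a * T with hs
  set t := t₀ + b * T with ht
  have hs0 : t₀ ≤ s := le_add_of_nonneg_right (by positivity)
  have hs1 : s < t₁ := by nlinarith
  have hst : s ≤ t := by nlinarith
  have ht1 : t ≤ t₁ := by nlinarith
  -- `taylor_mean_remainder_bound` expands at the left end of its interval, so it is applied on `[s,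
  -- t₁]`, where the one-sided derivatives agree with those on `[t₀, t₁]`.
  have hsub : Icc s t₁ ⊆ Icc t₀ t₁ := Icc_subset_Icc_left hs0
  have hder : ∀ j ≤ k + 1, ∀ y ∈ Icc s t₁,
      iteratedDerivWithin j X (Icc s t₁) y = iteratedDerivWithin j X (Icc t₀ t₁) y := by
    intro j hj y hy
    rw [iteratedDerivWithin, iteratedDerivWithin, iteratedFDerivWithin_subset hsub
      (uniqueDiffOn_Icc hs1) (uniqueDiffOn_Icc h01) (hX.of_le (by exact_mod_cast hj)) hy]
  have key := taylor_mean_remainder_bound (f := X) (n := k) (C := B / T ^ (k + 1)) (x := t) hs1.le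
    (by exact_mod_cast hX.mono hsub) ⟨hst, ht1⟩ (fun y hy => by
      rw [hder _ le_rfl y hy, le_div_iff₀ (by positivity), mul_comm]
      exact hB _ le_rfl y (hsub hy))
  have e : taylorWithinEval X k (Icc s t₁) s t = taylorWithinEval X k (Icc t₀ t₁) s t := by
    rw [taylor_within_apply, taylor_within_apply]
    refine Finset.sum_congr rfl fun j hj => ?_
    rw [hder j (by have := Finset.mem_range.1 hj; omega) s ⟨le_rfl, hs1.le⟩]
  rw [e] at key
  refine key.trans ?_
  have hB0 : 0 ≤ B := le_trans (by positivity) (hB 0 (Nat.zero_le _) t₀ ⟨le_rfl, h01.le⟩)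
  have e2 : B / T ^ (k + 1) * (t - s) ^ (k + 1) = B * (b - a) ^ (k + 1) := by
    rw [show t - s = (b - a) * T by rw [ht, hs]; ring, mul_pow]
    field_simp
  rw [e2]
  have : 0 ≤ b - a := sub_nonneg.2 hab
  exact div_le_self (by positivity) (by exact_mod_cast Nat.one_le_iff_ne_zero.2 k.factorial_ne_zero)

theorem RescaledDerivBound.norm_sub_le {m k : ℕ} {t₀ t₁ B : ℝ} (h01 : t₀ < t₁)
    {X : ℝ → Fin m → ℝ} (hX : ContDiffOn ℝ ((k + 1 : ℕ) : WithTop ℕ∞) X (Icc t₀ t₁))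
    (hB : RescaledDerivBound (k + 1) t₀ t₁ X B) {a b : ℝ} (ha : 0 ≤ a) (hab : a ≤ b) (hb : b < 1) :
    ‖X (t₀ + b * (t₁ - t₀)) - X (t₀ + a * (t₁ - t₀))‖ ≤ B * (b - a) := by
  have h := norm_sub_taylorWithinEval_le (k := 0) h01
    (hX.of_le (by exact_mod_cast Nat.succ_le_succ k.zero_le))
    (fun j hj => hB j (by omega)) ha hab hb
  simpa using h

open Polynomial in
/-- The Taylor polynomial of order `k` of the coordinate `j` of `X` at `t₀ + aT`, as a polynomial
in the variable `b` for which the time is `t₀ + bT`. -/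
noncomputable def rescaledTaylor {m : ℕ} (k : ℕ) (t₀ t₁ : ℝ) (X : ℝ → Fin m → ℝ) (a : ℝ)
    (j : Fin m) : ℝ[X] :=
  ∑ i ∈ Finset.range (k + 1), C ((i.factorial : ℝ)⁻¹ * (t₁ - t₀) ^ i *
    iteratedDerivWithin i X (Icc t₀ t₁) (t₀ + a * (t₁ - t₀)) j) * (Polynomial.X - C a) ^ i

theorem natDegree_rescaledTaylor_lt {m : ℕ} (k : ℕ) (t₀ t₁ : ℝ) (X : ℝ → Fin m → ℝ) (a : ℝ)
    (j : Fin m) : (rescaledTaylor k t₀ t₁ X a j).natDegree < k + 1 := by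
  refine Nat.lt_succ_of_le (Polynomial.natDegree_sum_le_of_forall_le _ _ fun i hi => ?_)
  refine (Polynomial.natDegree_C_mul_le _ _).trans ?_
  rw [Polynomial.natDegree_pow, Polynomial.natDegree_X_sub_C, mul_one]
  exact Nat.lt_succ_iff.1 (Finset.mem_range.1 hi)

theorem eval_rescaledTaylor {m : ℕ} (k : ℕ) (t₀ t₁ : ℝ) (X : ℝ → Fin m → ℝ) (a b : ℝ)
    (j : Fin m) : (rescaledTaylor k t₀ t₁ X a j).eval b =
      taylorWithinEval X k (Icc t₀ t₁) (t₀ + a * (t₁ - t₀)) (t₀ + b * (t₁ - t₀)) j := by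
  rw [taylor_within_apply, rescaledTaylor, Polynomial.eval_finsetSum, Finset.sum_apply]
  refine Finset.sum_congr rfl fun i _ => ?_
  simp only [Polynomial.eval_mul, Polynomial.eval_C, Polynomial.eval_pow, Polynomial.eval_sub,
    Polynomial.eval_X, Pi.smul_apply, smul_eq_mul]
  rw [show t₀ + b * (t₁ - t₀) - (t₀ + a * (t₁ - t₀)) = (t₁ - t₀) * (b - a) by ring, mul_pow]
  ring

-- The matrix of the shift depends on `δ` only, not on `P`, so its entries can serve as network
-- weights.
open Polynomial in
theorem coeff_taylor_eq_sum {n : ℕ} (δ : ℝ) {P : ℝ[X]} (hP : P.natDegree < n) (i : ℕ) :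
    (taylor δ P).coeff i =
      ∑ l : Fin n, (taylor δ ((Polynomial.X : ℝ[X]) ^ (l : ℕ))).coeff i * P.coeff l := by
  conv_lhs => rw [P.as_sum_range_C_mul_X_pow' hP]
  rw [map_sum, finsetSum_coeff, ← Fin.sum_univ_eq_sum_range (fun l =>
    (taylor δ (C (P.coeff l) * (Polynomial.X : ℝ[X]) ^ l)).coeff i)]
  refine Finset.sum_congr rfl fun l _ => ?_
  rw [taylor_mul, taylor_C, coeff_C_mul, mul_comm]

/-! ### The networks for a given `w`. -/

/-- The count for `w²` cells, `m(k+1)` coefficients and `2k` stages. Taking `w²` cells but only `w`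
shifts per stage balances the cost: a stage has layers of width of order `w` on both sides. -/
theorem relu_network_size_le {m k w : ℕ} (hm : 0 < m) (hw : 0 < w) :
    2 * (4 * w ^ 2 + 1) + (4 * w ^ 2 + 2) * (m * (k + 1) + 1) +
      2 * k * ((m * (k + 1) + 2) * (4 * w + m * (k + 1) + 1) +
        (4 * w + m * (k + 1) + 2) * (w * (m * (k + 1)) + 1) +
        (w * (m * (k + 1)) + 2) * (m * (k + 1) + 1)) +
      ((m * (k + 1) + 2) * (2 * m) + (2 * m + 1) * m) ≤
    (31 + 76 * k) * (w * (m * (k + 1))) ^ 2 := by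
  have hmq : m ≤ m * (k + 1) := Nat.le_mul_of_pos_right _ k.succ_pos
  set q := m * (k + 1)
  have hq : 1 ≤ q := hm.trans_le hmq
  have hw1 : w ≤ w * q := Nat.le_mul_of_pos_right _ hq
  have hq1 : q ≤ w * q := Nat.le_mul_of_pos_left _ hw
  have h1 : 1 ≤ w * q := hq.trans hq1
  set z := w * q
  have b1 : (4 * w ^ 2 + 2) * (q + 1) ≤ 12 * z ^ 2 := by
    have : w ^ 2 * q ≤ z ^ 2 := by
      calc w ^ 2 * q ≤ w ^ 2 * (q * q) := Nat.mul_le_mul_left _ (Nat.le_mul_of_pos_left _ hq)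
        _ = z ^ 2 := by simp only [z]; ring
    nlinarith
  have b2 : (q + 2) * (4 * w + q + 1) ≤ (3 * z) * (6 * z) := Nat.mul_le_mul (by omega) (by omega)
  have b3 : (4 * w + q + 2) * (z + 1) ≤ (7 * z) * (2 * z) := Nat.mul_le_mul (by omega) (by omega)
  have b4 : (z + 2) * (q + 1) ≤ (3 * z) * (2 * z) := Nat.mul_le_mul (by omega) (by omega)
  have b5 : (q + 2) * (2 * m) ≤ (3 * z) * (2 * z) := Nat.mul_le_mul (by omega) (by omega)
  have b6 : (2 * m + 1) * m ≤ (3 * z) * z := Nat.mul_le_mul (by omega) (by omega)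
  have b7 : 2 * (4 * w ^ 2 + 1) ≤ 10 * z ^ 2 := by nlinarith
  have b8 := Nat.mul_le_mul_left (2 * k) (add_le_add (add_le_add b2 b3) b4)
  nlinarith

/-- The two contributions to `2B` are the Taylor remainder at `τ` and the change of `X` between `τ`
and the true time. The end point `t₁` is excluded because it lies in no half-open cell. -/
theorem exists_network_family {m k w : ℕ} {t₀ t₁ B : ℝ} (hm : 0 < m) (h01 : t₀ < t₁)
    {X : ℝ → Fin m → ℝ} (hX : ContDiffOn ℝ ((k + 1 : ℕ) : WithTop ℕ∞) X (Icc t₀ t₁))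
    (hB : RescaledDerivBound (k + 1) t₀ t₁ X B) (hw : 0 < w) :
    ∃ Φ : ℕ → NeuralNetwork 1 m,
      (∀ M, (Φ M).depth = 6 * k + 4) ∧
      (∀ M, (Φ M).size ≤ (31 + 76 * k) * (w * (m * (k + 1))) ^ 2) ∧
      (∀ M (x : Fin 1 → ℝ) j, |(Φ M).realize relu x j| ≤ B) ∧
      ∀ t ∈ Ico t₀ t₁, ∃ y : Fin m → ℝ, (∀ j, |y j - X t j| ≤ 2 * B / w ^ (2 * (k + 1))) ∧
        ∀ᶠ M in Filter.atTop, (Φ M).realize relu (fun _ => t) = y := by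
  have hT : 0 < t₁ - t₀ := sub_pos.2 h01
  have hw' : (0 : ℝ) < w := by exact_mod_cast hw
  have hXB : ∀ t ∈ Icc t₀ t₁, ‖X t‖ ≤ B := fun t ht => by
    simpa using hB 0 (Nat.zero_le _) t ht
  have hB0 : 0 ≤ B := (norm_nonneg _).trans (hXB t₀ ⟨le_rfl, h01.le⟩)
  let P : Fin (w ^ 2) → Fin m → Polynomial ℝ := fun ν j =>
    rescaledTaylor k t₀ t₁ X (((ν : ℕ) : ℝ) / (w ^ 2 : ℕ)) j
  let V : Fin (w ^ 2) → ℝ → (Fin m × Fin (k + 1)) → ℝ := fun ν τ s =>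
    (Polynomial.taylor τ (P ν s.1)).coeff s.2
  let D : ℝ → ((Fin m × Fin (k + 1)) → ℝ) → ((Fin m × Fin (k + 1)) → ℝ) := fun δ v s =>
    ∑ l : Fin (k + 1),
      (Polynomial.taylor δ ((Polynomial.X : Polynomial ℝ) ^ (l : ℕ))).coeff s.2 * v (s.1, l)
  have hD : ∀ δ s, IsAffineFun (fun v => D δ v s) := fun δ s =>
    IsAffineFun.sum _ fun l => (IsAffineFun.coord _).const_mul _
  have hDV : ∀ ν τ δ, D δ (V ν τ) = V ν (τ + δ) := by
    intro ν τ δ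
    funext s
    simp only [V, D]
    rw [add_comm τ δ, ← Polynomial.taylor_taylor, ← coeff_taylor_eq_sum]
    rw [Polynomial.natDegree_taylor]
    exact natDegree_rescaledTaylor_lt _ _ _ _ _ _
  have hcont : Continuous (fun τ : ℝ => fun q : Fin (w ^ 2) × (Fin m × Fin (k + 1)) =>
      V q.1 τ q.2) := by
    refine continuous_pi fun q => ?_
    simp only [V, Polynomial.taylor_coeff]
    exact Polynomial.continuous _
  -- This `A` depends on `w` and `X`; it enters only the weights, hence not the size.
  obtain ⟨A, hA⟩ := (isCompact_Icc (a := (0 : ℝ)) (b := 2)).exists_bound_of_continuousOn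
    hcont.continuousOn
  have hVA : ∀ ν, ∀ τ ∈ Icc (0 : ℝ) 2, ∀ s, |V ν τ s| ≤ A := fun ν τ hτ s =>
    (norm_le_pi_norm (fun q : Fin (w ^ 2) × (Fin m × Fin (k + 1)) => V q.1 τ q.2) (ν, s)).trans
      (hA τ hτ)
  obtain ⟨F, hF, hF'⟩ := exists_isReLUNet_tower (A := A) (t₁ - t₀)⁻¹ (-t₀ * (t₁ - t₀)⁻¹)
    (pow_pos hw 2) hw V hVA D hD hDV (2 * k)
  obtain ⟨G, hG, hG', hGB⟩ := exists_isReLUNet_clip A hB0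
    (fun j : Fin m => ((j, 0) : Fin m × Fin (k + 1)))
  have hnet := fun M => hG.comp (hF M) (Equiv.refl _) (Equiv.refl _)
  choose Φ h1 h2 h3 using hnet
  have h3' : ∀ M (x : Fin 1 → ℝ) j,
      (Φ M).realize relu x j = G (fun k => relu (F M x k)) j := fun M x j => h3 M x j
  refine ⟨Φ, fun M => by rw [h1]; ring, fun M => ?_, fun M x j => ?_, fun t ht => ?_⟩
  · rw [h2]
    simpa using relu_network_size_le (k := k) hm hw
  · rw [h3']; exact hGB _ _
  · set b : ℝ := (t - t₀) / (t₁ - t₀) with hb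
    have hb0 : 0 ≤ b := div_nonneg (sub_nonneg.2 ht.1) hT.le
    have hb1 : b < 1 := by rw [hb, div_lt_one hT]; linarith [ht.2]
    have hbt : t₀ + b * (t₁ - t₀) = t := by rw [hb]; field_simp; ring
    have hφ : (t₁ - t₀)⁻¹ * (fun _ : Fin 1 => t) 0 + -t₀ * (t₁ - t₀)⁻¹ = b := by
      rw [hb]; field_simp; ring
    obtain ⟨ν, τ, h, g1, g2, g3, g4, g5, g6⟩ := hF' (fun _ => t) (by rw [hφ]; exact hb0)
      (by rw [hφ]; exact hb1)
    rw [hφ] at g2 g5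
    set a : ℝ := ((ν : ℕ) : ℝ) / (w ^ 2 : ℕ) with ha
    have ha0 : 0 ≤ a := by positivity
    have hτb : τ ≤ b := by
      have : 0 ≤ h / (((w ^ 2 : ℕ) : ℝ) * w ^ (2 * k)) := by positivity
      linarith
    have hτ0 : 0 ≤ τ := ha0.trans g1
    have hbτ : b - τ ≤ 1 / w ^ (2 * (k + 1)) := by
      have e : ((w ^ 2 : ℕ) : ℝ) * w ^ (2 * k) = w ^ (2 * (k + 1)) := by push_cast; ring
      rw [g5, e, add_sub_cancel_left]
      exact div_le_div_of_nonneg_right g4.le (by positivity)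
    have hτa : (τ - a) ^ (k + 1) ≤ 1 / w ^ (2 * (k + 1)) := by
      have : τ - a ≤ 1 / w ^ 2 := by
        rw [add_div] at g2
        push_cast at g2 ha
        linarith
      calc (τ - a) ^ (k + 1) ≤ (1 / (w : ℝ) ^ 2) ^ (k + 1) :=
            pow_le_pow_left₀ (sub_nonneg.2 g1) this _
        _ = _ := by rw [div_pow, one_pow, ← pow_mul]
    refine ⟨fun j => max (-B) (min B (V ν τ (j, 0))), fun j => ?_, ?_⟩
    · have c1 : V ν τ (j, 0) =
          taylorWithinEval X k (Icc t₀ t₁) (t₀ + a * (t₁ - t₀)) (t₀ + τ * (t₁ - t₀)) j := by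
        change (Polynomial.taylor τ (P ν j)).coeff 0 = _
        rw [Polynomial.taylor_coeff_zero]
        exact eval_rescaledTaylor _ _ _ _ _ _ _
      have c2 := (norm_le_pi_norm _ j).trans
        (norm_sub_taylorWithinEval_le h01 hX hB ha0 g1 (hτb.trans_lt hb1))
      have c3 := (norm_le_pi_norm _ j).trans (hB.norm_sub_le h01 hX hτ0 hτb hb1)
      rw [Pi.sub_apply, Real.norm_eq_abs] at c2 c3
      rw [← c1] at c2
      rw [hbt] at c3
      have c4 : |X t j| ≤ B := (norm_le_pi_norm (X t) j).trans (hXB t (Ico_subset_Icc_self ht))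
      have c5 : |V ν τ (j, 0) - X t j| ≤ 2 * B / w ^ (2 * (k + 1)) := by
        have d2 := mul_le_mul_of_nonneg_left hτa hB0
        have d3 := mul_le_mul_of_nonneg_left hbτ hB0
        have d4 : 2 * B / (w : ℝ) ^ (2 * (k + 1)) = B * (1 / w ^ (2 * (k + 1))) +
          B * (1 / w ^ (2 * (k + 1))) := by ring
        rw [abs_le] at c2 c3 ⊢
        rw [d4]
        constructor <;> linarith [c2.1, c2.2, c3.1, c3.2]
      -- Clipping fixes `X t j` and is 1-Lipschitz, so it does not enlarge the error.
      have c6 : max (-B) (min B (X t j)) = X t j := by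
        rw [min_eq_right (abs_le.1 c4).2, max_eq_right (abs_le.1 c4).1]
      refine le_trans ?_ c5
      have := ((LipschitzWith.id.const_min B).const_max (-B)).dist_le_mul (V ν τ (j, 0)) (X t j)
      simpa [Real.dist_eq, c6] using this
    · filter_upwards [g6] with M hM
      funext j
      rw [h3', hM, relu_encode g3 (hVA ν τ ⟨hτ0, by linarith⟩), hG']

/-! ### Convergence in `L^p` and choice of parameters. -/

-- Almost everywhere the integrands are eventually constant in `M`, and `B ^ p` dominates them. The
-- limit is at most `m * (t₁ - t₀) * δ ^ p`, so the gap `δ < η` gives the strict inequality for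
-- large `M`.
open Filter Topology MeasureTheory in
theorem eventually_lpNormOn_lt {m : ℕ} {p t₀ t₁ B δ η : ℝ} (hm : 0 < m) (hp : 0 < p)
    (h01 : t₀ < t₁) {X : ℝ → Fin m → ℝ} (hX : ContinuousOn X (Icc t₀ t₁)) {F : ℕ → ℝ → Fin m → ℝ}
    (hF : ∀ M, Continuous (F M)) (hFB : ∀ M, ∀ t ∈ Icc t₀ t₁, ∀ j, |F M t j - X t j| ≤ B)
    (hδ : 0 ≤ δ) (hδη : δ < η)
    (hlim : ∀ t ∈ Ico t₀ t₁, ∃ y : Fin m → ℝ, (∀ j, |y j - X t j| ≤ δ) ∧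
      ∀ᶠ M in atTop, F M t = y) :
    ∀ᶠ M in atTop, lpNormOn p t₀ t₁ (fun t => F M t - X t) < ((m : ℝ) * (t₁ - t₀)) ^ (1 / p) * η := by
  have hT : 0 < t₁ - t₀ := sub_pos.2 h01
  have hm' : (0 : ℝ) < m := by exact_mod_cast hm
  have hη : 0 < η := hδ.trans_lt hδη
  have hae : ∀ᵐ t : ℝ, t ≠ t₁ := by
    simp [ae_iff]
  choose! y hy hyF using hlim
  have hmem : ∀ t ∈ uIoc t₀ t₁, t ∈ Icc t₀ t₁ := fun t ht => by
    rw [uIoc_of_le h01.le] at ht; exact Ioc_subset_Icc_self ht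
  have hmem' : ∀ t, t ≠ t₁ → t ∈ uIoc t₀ t₁ → t ∈ Ico t₀ t₁ := fun t h ht =>
    ⟨(hmem t ht).1, lt_of_le_of_ne (hmem t ht).2 h⟩
  have hconv : Tendsto (fun M => ∑ j, ∫ t in t₀..t₁, |(F M t - X t) j| ^ p) atTop
      (𝓝 (∑ j, ∫ t in t₀..t₁, |(y t - X t) j| ^ p)) := by
    refine tendsto_finsetSum _ fun j _ => ?_
    refine intervalIntegral.tendsto_integral_filter_of_dominated_convergence (fun _ => B ^ p)
      (Eventually.of_forall fun M => ?_) (Eventually.of_forall fun M => ?_) (by simp) ?_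
    · rw [uIoc_of_le h01.le]
      refine ContinuousOn.aestronglyMeasurable ?_ measurableSet_Ioc
      have h1 : ContinuousOn (fun t => (F M t - X t) j) (Ioc t₀ t₁) :=
        (continuous_apply j).comp_continuousOn
          ((hF M).continuousOn.sub (hX.mono Ioc_subset_Icc_self))
      exact h1.abs.rpow_const fun _ _ => Or.inr hp.le
    · refine Eventually.of_forall fun t ht => ?_
      rw [Real.norm_of_nonneg (by positivity)]
      exact Real.rpow_le_rpow (abs_nonneg _) (hFB M t (hmem t ht) j) hp.le
    · filter_upwards [hae] with t ht htI
      refine tendsto_const_nhds.congr' ?_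
      filter_upwards [hyF t (hmem' t ht htI)] with M hM
      rw [hM]
  have hle : ∑ j, ∫ t in t₀..t₁, |(y t - X t) j| ^ p ≤ m * (t₁ - t₀) * δ ^ p := by
    have : ∀ j, ∫ t in t₀..t₁, |(y t - X t) j| ^ p ≤ δ ^ p * (t₁ - t₀) := by
      intro j
      have := intervalIntegral.norm_integral_le_of_norm_le_const_ae (a := t₀) (b := t₁)
        (f := fun t => |(y t - X t) j| ^ p) (C := δ ^ p) (by
          filter_upwards [hae] with t ht htI
          rw [Real.norm_of_nonneg (by positivity)]
          exact Real.rpow_le_rpow (abs_nonneg _) (hy t (hmem' t ht htI) j) hp.le)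
      rw [abs_of_pos hT] at this
      exact (le_abs_self _).trans this
    calc _ ≤ ∑ _j : Fin m, δ ^ p * (t₁ - t₀) := Finset.sum_le_sum fun j _ => this j
      _ = _ := by simp; ring
  have hlt : ∑ j, ∫ t in t₀..t₁, |(y t - X t) j| ^ p < m * (t₁ - t₀) * η ^ p :=
    hle.trans_lt (mul_lt_mul_of_pos_left (Real.rpow_lt_rpow hδ hδη hp) (by positivity))
  filter_upwards [hconv.eventually (gt_mem_nhds hlt)] with M hM
  have h0 : 0 ≤ ∑ j, ∫ t in t₀..t₁, |(F M t - X t) j| ^ p := Finset.sum_nonneg fun j _ =>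
    intervalIntegral.integral_nonneg h01.le fun t _ => by positivity
  calc lpNormOn p t₀ t₁ (fun t => F M t - X t)
      < (m * (t₁ - t₀) * η ^ p) ^ (1 / p) := Real.rpow_lt_rpow h0 hM (by positivity)
    _ = _ := by
      rw [Real.mul_rpow (by positivity) (by positivity), ← Real.rpow_mul hη.le,
        mul_one_div_cancel hp.ne', Real.rpow_one]

theorem exists_nat_pow_ge {n : ℕ} (hn : 0 < n) {a : ℝ} (ha : 1 ≤ a) :
    ∃ w : ℕ, 0 < w ∧ a ≤ (w : ℝ) ^ (2 * n) ∧ (w : ℝ) ^ 2 ≤ 4 * a ^ (1 / (n : ℝ)) := by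
  have hn' : (0 : ℝ) < n := by exact_mod_cast hn
  have ha0 : (0 : ℝ) ≤ a := by linarith
  set u : ℝ := a ^ (1 / (2 * n : ℝ)) with hu
  have hu1 : 1 ≤ u := Real.one_le_rpow ha (by positivity)
  have hc := Nat.le_ceil u
  have hc' := Nat.ceil_lt_add_one (zero_le_one.trans hu1)
  -- Since `u ≥ 1`, rounding up at most doubles it, whence the factor 4 in the square.
  refine ⟨⌈u⌉₊, Nat.ceil_pos.2 (by linarith), ?_, ?_⟩
  · calc a = u ^ (2 * n) := by
          rw [hu, ← Real.rpow_natCast, ← Real.rpow_mul ha0]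
          push_cast
          rw [one_div_mul_cancel (by positivity), Real.rpow_one]
      _ ≤ _ := pow_le_pow_left₀ (by linarith) hc _
  · have e : u ^ 2 = a ^ (1 / (n : ℝ)) := by
      rw [hu, ← Real.rpow_natCast, ← Real.rpow_mul ha0]
      congr 1
      push_cast
      field_simp
    rw [← e]
    nlinarith

/-- For `k ≥ 9` the logarithm contributes at least 4, so the right side also has slope at least 6 in
`k`; for smaller `k` the constant 12 suffices. -/
theorem depth_le_of_logb (k : ℕ) :
    6 * k + 4 ≤ (2 + ⌈Real.logb 2 ((k : ℝ) + 1)⌉₊) * (12 + k) := by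
  have hlog : ∀ n : ℕ, 2 ^ n < k + 1 → n + 1 ≤ ⌈Real.logb 2 ((k : ℝ) + 1)⌉₊ := by
    intro n hn
    refine Nat.succ_le_of_lt (Nat.lt_ceil.2 ?_)
    rw [Real.lt_logb_iff_rpow_lt (by norm_num) (by positivity), Real.rpow_natCast]
    exact_mod_cast hn
  generalize ⌈Real.logb 2 ((k : ℝ) + 1)⌉₊ = c at hlog
  rcases lt_or_ge k 3 with h | h
  · nlinarith
  · rcases lt_or_ge k 9 with h' | h'
    · have := hlog 1 (by omega)
      nlinarith
    · have := hlog 3 (by omega)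
      nlinarith

theorem exists_network_approx {m k : ℕ} {p t₀ t₁ B ε : ℝ} (hm : 0 < m) (hp : 0 < p)
    (h01 : t₀ < t₁) {X : ℝ → Fin m → ℝ}
    (hX : ContDiffOn ℝ ((k + 1 : ℕ) : WithTop ℕ∞) X (Icc t₀ t₁))
    (hB : RescaledDerivBound (k + 1) t₀ t₁ X B) (hε : 0 < ε)
    (hε' : ε ≤ ((m : ℝ) * (t₁ - t₀)) ^ (1 / p)) :
    ∃ Φ : NeuralNetwork 1 m,
      lpNormOn p t₀ t₁ (fun t => Φ.realize relu (fun _ => t) - X t) < ε ∧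
      (∀ (t : ℝ) (j : Fin m), |Φ.realize relu (fun _ => t) j| ≤ B) ∧
      Φ.depth = 6 * k + 4 ∧
      (Φ.size : ℝ) ≤ (m : ℝ) *
        (4 * (31 + 76 * k) * (k + 1) ^ 2 * (2 * B + 1) ^ (1 / ((k : ℝ) + 1)) *
          (m : ℝ) ^ (1 + 1 / (p * ((k : ℝ) + 1)))) *
        (ε / (t₁ - t₀) ^ (1 / p)) ^ (-(1 / ((k : ℝ) + 1))) := by
  have hT : 0 < t₁ - t₀ := sub_pos.2 h01
  have hm' : (0 : ℝ) < m := by exact_mod_cast hm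
  have hXB : ∀ t ∈ Icc t₀ t₁, ‖X t‖ ≤ B := fun t ht => by
    simpa using hB 0 (Nat.zero_le _) t ht
  have hB0 : 0 ≤ B := (norm_nonneg _).trans (hXB t₀ ⟨le_rfl, h01.le⟩)
  have hmT : 0 < ((m : ℝ) * (t₁ - t₀)) ^ (1 / p) := by positivity
  set η : ℝ := ε / ((m : ℝ) * (t₁ - t₀)) ^ (1 / p) with hη
  have hη0 : 0 < η := by positivity
  have hη1 : η ≤ 1 := (div_le_one hmT).2 hε'
  have hC : 0 < 2 * B + 1 := by linarith
  -- `η` is the pointwise tolerance corresponding to `ε`. The `+ 1` makes the error strictly smaller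
  -- than `η` and keeps `a ≥ 1` even when `B = 0`.
  obtain ⟨w, hw, hw1, hw2⟩ := exists_nat_pow_ge k.succ_pos (a := (2 * B + 1) / η)
    ((one_le_div hη0).2 (by linarith))
  obtain ⟨Φ, h1, h2, h3, h4⟩ := exists_network_family hm h01 hX hB hw
  have hw' : (0 : ℝ) < w := by exact_mod_cast hw
  have hδ : 2 * B / (w : ℝ) ^ (2 * (k + 1)) < η := by
    rw [div_le_iff₀ hη0] at hw1
    rw [div_lt_iff₀ (by positivity)]
    have : (w : ℝ) ^ (2 * (k + 1)) * η = η * w ^ (2 * (k + 1)) := mul_comm _ _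
    simp only [Nat.succ_eq_add_one] at hw1
    linarith
  have hev := eventually_lpNormOn_lt (p := p) (B := 2 * B)
    (F := fun M t => (Φ M).realize relu (fun _ => t)) hm hp h01 hX.continuousOn
    (fun M => ((Φ M).continuous_realize continuous_relu).comp
      (continuous_pi fun _ => continuous_id))
    (fun M t ht j => by
      have e1 := abs_le.1 (h3 M (fun _ => t) j)
      have e2 := abs_le.1 ((norm_le_pi_norm (X t) j).trans (hXB t ht))
      rw [abs_le]
      constructor <;> linarith [e1.1, e1.2, e2.1, e2.2])
    (by positivity) hδ h4
  obtain ⟨M, hM⟩ := hev.exists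
  refine ⟨Φ M, ?_, fun t j => h3 M _ j, h1 M, ?_⟩
  · rwa [hη, mul_div_cancel₀ _ hmT.ne'] at hM
  · have hsize : ((Φ M).size : ℝ) ≤ (31 + 76 * k) * (w * (m * (k + 1))) ^ 2 := by
      exact_mod_cast h2 M
    have e1 : (η : ℝ) = ε / (t₁ - t₀) ^ (1 / p) / (m : ℝ) ^ (1 / p) := by
      rw [hη, Real.mul_rpow hm'.le hT.le, div_div, mul_comm ((m : ℝ) ^ (1 / p))]
    have e2 : ((2 * B + 1) / η) ^ (1 / ((k : ℝ) + 1)) = (2 * B + 1) ^ (1 / ((k : ℝ) + 1)) *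
        ((ε / (t₁ - t₀) ^ (1 / p)) ^ (-(1 / ((k : ℝ) + 1))) *
          (m : ℝ) ^ (1 / (p * ((k : ℝ) + 1)))) := by
      rw [Real.div_rpow hC.le hη0.le, e1, Real.div_rpow (by positivity) (by positivity),
        ← Real.rpow_mul hm'.le, one_div_mul_one_div, Real.rpow_neg (by positivity),
        div_div_eq_mul_div, mul_div_assoc, mul_div_assoc', mul_comm (_ ⁻¹), ← div_eq_mul_inv]
      ring
    rw [Nat.succ_eq_add_one, Nat.cast_add, Nat.cast_one, e2] at hw2
    rw [Real.rpow_add hm', Real.rpow_one]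
    calc ((Φ M).size : ℝ) ≤ ((31 + 76 * k) * (m * (k + 1)) ^ 2) * (w : ℝ) ^ 2 :=
          hsize.trans_eq (by ring)
      _ ≤ _ := mul_le_mul_of_nonneg_left hw2 (by positivity)
      _ = _ := by ring
theorem corollary4p9 :
    ∃ (c₀ : ℕ → ℝ → ℝ) (K : ℝ → ℝ), (∀ k B, 0 < c₀ k B) ∧
      ∀ (m k : ℕ) (p t₀ t₁ : ℝ) (f : ℝ → (Fin m → ℝ) → (Fin m → ℝ)) (x₀ : Fin m → ℝ),
        0 < m → 0 < p → t₀ < t₁ →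
        ContDiffOn ℝ (k : WithTop ℕ∞) (fun z : ℝ × (Fin m → ℝ) => f z.1 z.2)
          (Icc t₀ t₁ ×ˢ (univ : Set (Fin m → ℝ))) →
        (∃ Λ : NNReal, ∀ t ∈ Icc t₀ t₁, LipschitzWith Λ (f t)) →
        ∃ X : ℝ → Fin m → ℝ,
          IsCauchySolution t₀ t₁ f x₀ X ∧
          (∀ Y : ℝ → Fin m → ℝ, IsCauchySolution t₀ t₁ f x₀ Y → EqOn Y X (Icc t₀ t₁)) ∧
          ContDiffOn ℝ ((k + 1 : ℕ) : WithTop ℕ∞) X (Icc t₀ t₁) ∧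
          (∃ B : ℝ, RescaledDerivBound (k + 1) t₀ t₁ X B) ∧
          ∀ B : ℝ, RescaledDerivBound (k + 1) t₀ t₁ X B →
            ∀ ε : ℝ, 0 < ε → ε < ((m : ℝ) * (t₁ - t₀)) ^ (1 / p) / 2 →
              ∃ Φ : NeuralNetwork 1 m,
                lpNormOn p t₀ t₁ (fun t => Φ.realize relu (fun _ => t) - X t) < ε ∧
                (∀ (t : ℝ) (j : Fin m), |Φ.realize relu (fun _ => t) j| ≤ K B) ∧
                Φ.depth ≤ (2 + ⌈Real.logb 2 ((k : ℝ) + 1)⌉₊) * (12 + k) ∧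
                (Φ.size : ℝ) ≤
                  (m : ℝ) * (c₀ k B * (m : ℝ) ^ (1 + 1 / (p * ((k : ℝ) + 1)))) *
                    (ε / (t₁ - t₀) ^ (1 / p)) ^ (-(1 / ((k : ℝ) + 1))) := by
  -- The absolute value makes `c₀` positive for every real `B`, including negative ones; a
  -- derivative bound by `B` is also one by `|B|`.
  refine ⟨fun k B => 4 * (31 + 76 * k) * (k + 1) ^ 2 * (2 * |B| + 1) ^ (1 / ((k : ℝ) + 1)),
    fun B => |B|, fun k B => by positivity, ?_⟩
  rintro m k p t₀ t₁ f x₀ hm hp h01 hf ⟨Λ, hΛ⟩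
  obtain ⟨X, hX⟩ := exists_isCauchySolution (x₀ := x₀) h01.le hf.continuousOn hΛ
  have hXc := hX.contDiffOn h01 hf
  refine ⟨X, hX, fun Y hY => hX.eqOn hΛ hY, hXc, exists_rescaledDerivBound h01 hXc,
    fun B hB ε hε hε' => ?_⟩
  have hB' : RescaledDerivBound (k + 1) t₀ t₁ X |B| := fun j hj t ht =>
    (hB j hj t ht).trans (le_abs_self B)
  obtain ⟨Φ, h1, h2, h3, h4⟩ := exists_network_approx hm hp h01 hXc hB' hε (by linarith)
  exact ⟨Φ, h1, h2, h3.trans_le (depth_le_of_logb k), h4⟩
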